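/- **Setting.** Let $\Sigma$ be a finite alphabet with at least two elements; $\log$ denotes $\log_{|\Sigma|}$ and $-\log 0=+\infty$. A set of strings is *prefix-free* if no member is a proper prefix of another. An *encoding* of a set is an injection into $\Sigma^*$ with decidable image. Fix a self-delimiting encoding $\overline{\,\cdot\,}:\Sigma^*\to\Sigma^*$ (total computable, injective, with decidable prefix-free image); tuples are encoded by $\langle s_0,\dots,s_m\rangle=\overline{s_0}\cdots\overline{s_{m-1}}\,s_m$. Fix encodings of $\mathbb N$, $\mathbb Q$, $\{0,1\}$ and $\{0,\dots,n-1\}^*$ ($n\in\mathbb N$), all of them computable functions, and encodings $\mathrm{Enc}_{\mathcal X},\mathrm{Enc}_{\mathcal Y}$ of the sets $\mathcal X,\mathcal Y$ below. (Partial) computability of functions between encoded sets means that they are induced on codes by a partial computable function $\Sigma^*\rightharpoonup\Sigma^*$. *Universal machine.* A partial computable $U:\Sigma^*\rightharpoonup\Sigma^*$ for which there is a decidable prefix-free set $\mathsf{Programs}\subseteq\Sigma^*$ such that for every partial computable $f:\Sigma^*\rightharpoonup\Sigma^*$ some $p\in\mathsf{Programs}$ satisfies $U(\overline{x}\,p\,w)=f(\overline{x}\,w)$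 for all $x,w\in\Sigma^*$ (equality including domains). Put $C_U(y\mid x)=\min\{|p| : U(\overline{\mathrm{Enc}_{\mathcal X}(x)}\,p)=\mathrm{Enc}_{\mathcal Y}(y)\}$. *Explanations.* Let $\Lambda$ be a finite set of characters with an injective code $\Lambda\to\Sigma^*$ whose image is prefix-free, let $L_\Lambda$ be the maximal length of a code word, and encode $\Lambda^*$ by concatenating code words. An *interpretation function* is a partial computable function $I:\Lambda^*\times\mathbb N\times\mathcal Y\rightharpoonup\mathbb Q$. A string $e\in\Lambda^*$ is a *completely faithful explanation* of $g:\mathcal Y\to\mathbb R$ if for all $y\in\mathcal Y$ and $k\in\mathbb N$ the value $I(e,k,y)$ is defined and $|I(e,k,y)-g(y)|<|\Sigma|^{-k}$. *Stochastic input-output AI.* Such an $A$ with domain $\mathcal X'\subseteq\mathcal X$ consists of an $n\in\mathbb N$ and partial computable functions $f:\{0,\dots,n-1\}^*\times\mathcal X\rightharpoonup\mathcal Y$ and $\tau:\{0,\dots,n-1\}^*\times\mathcal X\rightharpoonup\{0,1\}$ such that: $f(u,x)$ is undefined for all $u$ if $x\notin\mathcal X'$; for $x\in\mathcal X'$, $\tau(u,x)$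 is defined for all $u$, the set $\mathcal T_x=\{u:\tau(u,x)=1\}$ is prefix-free, and $f(u,x)$ is defined for all $u\in\mathcal T_x$; and there is a computable $N:\mathcal X'\times\mathbb N\to\mathbb N$ with $1-\sum_{u\in\mathcal T_x,\,|u|\le N(x,k)}n^{-|u|}\le|\Sigma|^{-k}$ for all $x\in\mathcal X'$, $k\in\mathbb N$. For $x\in\mathcal X'$ put $Q_A(y\mid x)=\sum_{u\in\mathcal T_x,\ f(u,x)=y}n^{-|u|}$. **Theorem (Fundamental Quadrilemma).** Fix a universal machine $U$, an encoded set $\mathcal Y$, a character set $\Lambda$ with its code, and an interpretation function $I$ as above. There is a constant $c\in\mathbb R$ such that for every encoded set $\mathcal X$ and every stochastic input-output AI $A$ with input space $\mathcal X$, output space $\mathcal Y$ and domain $\mathcal X'\subseteq\mathcal X$: (i) for all $x\in\mathcal X'$, $y\in\mathcal Y$ and every completely faithful explanation $e_x\in\Lambda^*$ of $Q_A(\cdot\mid x)$, $$-\log Q_A(y\mid x)+L_\Lambda|e_x|+2\log(L_\Lambda|e_x|+1)\ \ge\ C_U(y\mid x)+c;$$ (ii) if for every $x\in\mathcal X'$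 a completely faithful explanation $e_x\in\Lambda^*$ of $Q_A(\cdot\mid x)$ is given, then for every probability distribution $P$ on $\mathcal X'\times\mathcal Y$, $$\mathbb E_{(X,Y)\sim P}[-\log Q_A(Y\mid X)]+\mathbb E_{(X,Y)\sim P}\big[L_\Lambda|e_X|+2\log(L_\Lambda|e_X|+1)\big]\ \ge\ \mathbb E_{(X,Y)\sim P}[C_U(Y\mid X)]+c$$ as an inequality of extended real numbers. -/

import Mathlib

open scoped ENNReal

noncomputable section

namespace Quadrilemma

/-- A set of strings none of whose members properly extends another member. -/
def IsPrefixFree {A : Type*} (F : Set (List A)) : Prop :=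
  ∀ c ∈ F, ∀ z : List A, z ≠ [] → c ++ z ∉ F

section Computability

/- `S` is the (finite) alphabet of the computation model. Any two `Primcodable` structures on a
finite type give the same computable functions on `List S`. -/
variable {S : Type*} [Primcodable S]

/-- Encoding function of a set `Z`: injective, with decidable image. -/
def IsEncoding {Z : Type*} (enc : Z → List S) : Prop :=
  Function.Injective enc ∧ ComputablePred (fun s : List S => s ∈ Set.range enc)

/-- Self-delimiting encoding function `s ↦ s̄`: total computable, injective, with decidable
prefix-free image. -/
def IsSelfDelimiting (bar : List S → List S) : Prop :=
  Computable bar ∧ IsEncoding bar ∧ IsPrefixFree (Set.range bar)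

/-- Partial computability of `f : ⊆ Z → W` relative to string codes of `Z` and `W`; the equation is
one of partial values, so it includes the domains. -/
def PartialComputable {Z W : Type*} (encZ : Z → List S) (encW : W → List S) (f : Z →. W) : Prop :=
  ∃ g : List S →. List S, Partrec g ∧ ∀ z, g (encZ z) = (f z).map encW

/-- A computable encoding of the rationals: the code of `(a - b) / (c + 1)` can be computed from the
natural numbers `a`, `b`, `c`. -/
def ComputableRatEncoding (encQ : ℚ → List S) : Prop :=
  Computable fun t : ℕ × ℕ × ℕ => encQ (((t.1 : ℚ) - (t.2.1 : ℚ)) / ((t.2.2 : ℚ) + 1))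

/-- Code of a pair, `⟨a, b⟩ ↦ (code of a)‾ · (code of b)`. -/
def encPair {S : Type*} {Z W : Type*} (bar : List S → List S) (encZ : Z → List S)
    (encW : W → List S) (p : Z × W) : List S :=
  bar (encZ p.1) ++ encW p.2

/-- Universal conditional partial computable function. -/
def IsUniversalConditional (bar : List S → List S) (U : List S →. List S) : Prop :=
  Partrec U ∧ ∃ programs : Set (List S),
    ComputablePred (fun p : List S => p ∈ programs) ∧ IsPrefixFree programs ∧
      ∀ f : List S →. List S, Partrec f →
        ∃ p ∈ programs, ∀ x w : List S, U (bar x ++ p ++ w) = f (bar x ++ w)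

end Computability

/-- Conditional plain Kolmogorov complexity of the string `y` given the string `x`. For universal
`U` the set is nonempty, so this is a minimum. -/
def plainComplexity {S : Type*} (bar : List S → List S) (U : List S →. List S)
    (y x : List S) : ℕ :=
  sInf {m | ∃ p : List S, y ∈ U (bar x ++ p) ∧ p.length = m}

section Explanations

variable {S L : Type*}

/-- Character-by-character code of a string over the explanation alphabet `L`. -/
def encString (encL : L → List S) (e : List L) : List S := (e.map encL).flatten

/-- Maximal code length of a character. -/
def maxCodeLength [Fintype L] (encL : L → List S) : ℕ :=
  Finset.univ.sup fun a => (encL a).length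

/-- `e` is a completely faithful explanation of `f` under the interpretation function `I`: for all
`z` and `k`, `I (e, k, z)` is defined and lies within `|S| ^ (-k)` of `f z`. -/
def IsFaithfulExplanation (S : Type*) [Fintype S] {Z : Type*} (I : List L × ℕ × Z →. ℚ)
    (e : List L) (f : Z → ℝ) : Prop :=
  ∀ (z : Z) (k : ℕ), ∃ q ∈ I (e, k, z), |(q : ℝ) - f z| < ((Fintype.card S : ℝ) ^ k)⁻¹

end Explanations

/-- Stochastic input-output AI with input space `X` and output space `Y`. The maps `encX`, `encY`,
`encN`, `encB`, `encR n` are the codes of `X`, `Y`, `ℕ`, `{0, 1}` and `{0, …, n - 1}*`. -/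
structure StochasticAI {S X Y : Type*} [Primcodable S] [Fintype S] (bar : List S → List S)
    (encX : X → List S) (encY : Y → List S) (encN : ℕ → List S) (encB : Bool → List S)
    (encR : ∀ n : ℕ, List (Fin n) → List S) where
  /-- the domain -/
  dom : Set X
  /-- the number of values of the uniform random numbers -/
  n : ℕ
  /-- the main function -/
  main : List (Fin n) × X →. Y
  /-- the random-sequence acceptance decision function -/
  accept : List (Fin n) × X →. Bool
  main_computable : PartialComputable (encPair bar (encR n) encX) encY main
  accept_computable : PartialComputable (encPair bar (encR n) encX) encB accept
  main_undefined : ∀ x ∉ dom, ∀ u, ¬ (main (u, x)).Dom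
  accept_defined : ∀ x ∈ dom, ∀ u, (accept (u, x)).Dom
  accepted_prefixFree : ∀ x ∈ dom, IsPrefixFree {u | true ∈ accept (u, x)}
  /-- constructive stopping guarantee, with the computable bound `N` on the domain -/
  stopping : ∃ N : dom × ℕ → ℕ,
    PartialComputable (encPair bar (fun x : dom => encX x) encN) encN (N : dom × ℕ →. ℕ) ∧
      ∀ (x : dom) (k : ℕ),
        1 - ∑' u : {u : List (Fin n) // true ∈ accept (u, (x : X)) ∧ u.length ≤ N (x, k)},
            ((n : ℝ≥0∞)⁻¹) ^ u.1.length ≤ ((Fintype.card S : ℝ≥0∞)⁻¹) ^ k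
  main_defined : ∀ x ∈ dom, ∀ u, true ∈ accept (u, x) → (main (u, x)).Dom

/-- `A.prob x y` is `Q_A(y | x)`: the sum of `n ^ (-|u|)` over the accepted random sequences `u` with
`main (u, x) = y`. It is meaningful for `x ∈ A.dom`. -/
def StochasticAI.prob {S X Y : Type*} [Primcodable S] [Fintype S] {bar : List S → List S}
    {encX : X → List S} {encY : Y → List S} {encN : ℕ → List S} {encB : Bool → List S}
    {encR : ∀ n : ℕ, List (Fin n) → List S} (A : StochasticAI bar encX encY encN encB encR)
    (x : X) (y : Y) : ℝ≥0∞ :=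
  ∑' u : {u : List (Fin A.n) // true ∈ A.accept (u, x) ∧ y ∈ A.main (u, x)},
    ((A.n : ℝ≥0∞)⁻¹) ^ u.1.length

/-- `-log_b q`, equal to `+∞` at `q = 0` (used for `q ≤ 1`). -/
def negLog (b : ℕ) (q : ℝ≥0∞) : EReal :=
  if q = 0 then ⊤ else ((-Real.logb b q.toReal : ℝ) : EReal)

/-- Expectation of an extended real function under a discrete distribution, as the expectation of
the positive part minus that of the negative part. -/
def expect {Z : Type*} (P : PMF Z) (F : Z → EReal) : EReal :=
  ((∑' z, P z * (F z).toENNReal : ℝ≥0∞) : EReal) -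
    ((∑' z, P z * (-F z).toENNReal : ℝ≥0∞) : EReal)

end Quadrilemma

end

open scoped ENNReal

/-! A faithful explanation `e` of `Q_A(· | x)` computes every probability to any precision, so it
can replace the AI in a description of `y`. With `B = |Σ|` and `m = ⌈-log Q_A(y | x)⌉`, evaluate `I`
at precision `k = m + 2` and keep the outputs whose approximate value exceeds `B ^ (1 - k)`. Then
`y` is kept, every kept output has probability at least `B ^ (-k)`, and by Kraft's inequality the
probabilities sum to at most 1; hence at most `B ^ k` outputs are kept, and the rank of `y` among
them fits in `k` letters. The code of `e`, made self-delimiting at twice the logarithm of its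
length, followed by these letters, determines `y` (`exists_partrec_decoder`); the universal machine
adds only the length of one fixed program. The decoder discards `x`, which matters only through `e`.

This pointwise bound gives (i). Averaging it gives (ii), as all terms are nonnegative on the support
of `P`. -/

namespace Quadrilemma

/-! ### Computable searches: ranks, rational comparisons, prefix removal. -/

section Search

/-- A partial computable search for the member with a given rank of a decidable set. -/
theorem exists_partrec_nth {α : Type*} [Primcodable α] {P : α → ℕ →. Bool} (hP : Partrec₂ P) :
    ∃ F : α → ℕ →. ℕ, Partrec₂ F ∧ ∀ (a : α) (p : ℕ → Prop) [DecidablePred p],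
      (∀ n, P a n = Part.some (decide (p n))) → ∀ n, p n → n ∈ F a (Nat.count p n) := by
  let cnt : α → ℕ →. ℕ := fun a n => Nat.rec (motive := fun _ => Part ℕ) (Part.some 0)
    (fun m IH => IH.bind fun c => (P a m).map fun b => cond b (c + 1) c) n
  have hcnt : Partrec₂ cnt := by
    refine Partrec.nat_rec (f := fun q : α × ℕ => q.2) (g := fun _ => Part.some 0)
      (h := fun q r => (P q.1 r.1).map fun b => cond b (r.2 + 1) r.2)
      Computable.snd (Computable.const 0) ?_
    refine Partrec.map (hP.comp (Computable.fst.comp Computable.fst)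
      (Computable.fst.comp Computable.snd)) ?_
    have hc : Computable fun q : ((α × ℕ) × ℕ × ℕ) × Bool => q.1.2.2 :=
      Computable.snd.comp (Computable.snd.comp Computable.fst)
    exact Computable.cond Computable.snd (Computable.succ.comp hc) hc
  have cnt_eq : ∀ (a : α) (p : ℕ → Prop) [DecidablePred p],
      (∀ n, P a n = Part.some (decide (p n))) → ∀ n, cnt a n = Part.some (Nat.count p n) := by
    intro a p _ h n
    induction n with
    | zero => simp [cnt]
    | succ n ih =>
      change (cnt a n).bind _ = _
      rw [ih, Part.bind_some, h, Part.map_some, Nat.count_succ]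
      by_cases hn : p n <;> simp [hn]
  -- Search for a member with exactly `j` members below it; `Nat.count_injective` makes it unique.
  refine ⟨fun a j => Nat.rfind fun n =>
    (cnt a n).bind fun c => (P a n).map fun b => b && decide (c = j), ?_, ?_⟩
  · refine Partrec.rfind (p := fun (q : α × ℕ) n =>
      (cnt q.1 n).bind fun c => (P q.1 n).map fun b => b && decide (c = q.2)) ?_
    refine Partrec.bind (hcnt.comp (Computable.fst.comp Computable.fst) Computable.snd) ?_
    refine Partrec.map (hP.comp (Computable.fst.comp (Computable.fst.comp Computable.fst))
      (Computable.snd.comp Computable.fst)) ?_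
    refine Primrec.to_comp ?_
    refine Primrec.and.comp Primrec.snd ?_
    exact (PrimrecRel.comp Primrec.eq (Primrec.snd.comp Primrec.fst)
      (Primrec.snd.comp (Primrec.fst.comp (Primrec.fst.comp Primrec.fst)))).decide
  · intro a p _ h n hn
    have key : ∀ m, ((cnt a m).bind fun c =>
        (P a m).map fun b => b && decide (c = Nat.count p n)) =
        Part.some (decide (p m) && decide (Nat.count p m = Nat.count p n)) := by
      intro m
      rw [cnt_eq a p h, Part.bind_some, h, Part.map_some]
    refine Nat.mem_rfind.2 ⟨(congrArg (true ∈ ·) (key n)).mpr (by simp [hn]), fun {m} hm =>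
      (congrArg (false ∈ ·) (key m)).mpr ?_⟩
    simp only [Part.mem_some_iff]
    by_contra hc
    have : p m ∧ Nat.count p m = Nat.count p n := by simpa using hc
    exact hm.ne (Nat.count_injective this.1 hn this.2)

variable {S : Type*} [Primcodable S]

/-- Under a computable encoding of the rationals, the scaled comparison `B < q * B ^ k` is
decidable from the code of `q`. -/
theorem exists_partrec_rat_test {encQ : ℚ → List S} (hQ : Function.Injective encQ)
    (hQc : ComputableRatEncoding encQ) (B : ℕ) :
    ∃ T : ℕ → List S →. Bool, Partrec₂ T ∧
      ∀ k q, T k (encQ q) = Part.some (decide ((B : ℚ) < q * (B : ℚ) ^ k)) := by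
  classical
  let t : ℕ → ℕ × ℕ × ℕ := Denumerable.ofNat (ℕ × ℕ × ℕ)
  have ht : Primrec t := Primrec.ofNat _
  let r : ℕ × ℕ × ℕ → ℚ := fun t => ((t.1 : ℚ) - (t.2.1 : ℚ)) / ((t.2.2 : ℚ) + 1)
  have hpow : Primrec₂ ((· ^ ·) : ℕ → ℕ → ℕ) := by
    refine (Primrec.nat_rec (f := fun _ : ℕ => 1) (g := fun a q => q.2 * a) (Primrec.const 1)
      (Primrec.nat_mul.comp (Primrec.snd.comp Primrec.snd) Primrec.fst)).of_eq ?_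
    intro a n
    induction n with
    | zero => simp
    | succ n ih => simp [ih, pow_succ]
  -- The code `s` is inverted by searching for a triple `(a, b, c)` whose rational has code `s`;
  -- clearing the denominator `c + 1` leaves a comparison of natural numbers.
  refine ⟨fun k s => (Nat.rfind fun i => Part.some (decide (encQ (r (t i)) = s))).map fun i =>
    decide ((t i).2.1 * B ^ k + B * ((t i).2.2 + 1) < (t i).1 * B ^ k), ?_, ?_⟩
  · refine Partrec.map (f := fun q : ℕ × List S =>
      Nat.rfind fun i => Part.some (decide (encQ (r (t i)) = q.2)))
      (g := fun q i => decide ((t i).2.1 * B ^ q.1 + B * ((t i).2.2 + 1) < (t i).1 * B ^ q.1))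
      (Partrec.rfind ?_) ?_
    · have : Computable₂ fun (q : ℕ × List S) (i : ℕ) => decide (encQ (r (t i)) = q.2) := by
        have h2 : Computable₂ fun a b : List S => decide (a = b) :=
          Primrec₂.to_comp (Primrec.eq (α := List S)).decide
        exact h2.comp (hQc.comp (ht.to_comp.comp Computable.snd))
          (Computable.snd.comp Computable.fst)
      exact this
    · refine Primrec.to_comp ?_
      have ht' : Primrec fun q : (ℕ × List S) × ℕ => t q.2 := ht.comp Primrec.snd
      have hB : Primrec fun q : (ℕ × List S) × ℕ => B ^ q.1.1 :=
        hpow.comp (Primrec.const B) (Primrec.fst.comp Primrec.fst)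
      refine (PrimrecRel.comp Primrec.nat_lt (Primrec.nat_add.comp
        (Primrec.nat_mul.comp (Primrec.fst.comp (Primrec.snd.comp ht')) hB)
        (Primrec.nat_mul.comp (Primrec.const B)
          (Primrec.succ.comp (Primrec.snd.comp (Primrec.snd.comp ht')))))
        (Primrec.nat_mul.comp (Primrec.fst.comp ht') hB)).decide
  · intro k q
    have hex : ∃ i, r (t i) = q := by
      refine ⟨Encodable.encode ((q.num.toNat, (-q.num).toNat, q.den - 1) : ℕ × ℕ × ℕ), ?_⟩
      have hd : ((q.den - 1 : ℕ) : ℚ) + 1 = q.den := by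
        have := q.den_pos
        exact_mod_cast Nat.sub_add_cancel this
      have hn : ((q.num.toNat : ℕ) : ℚ) - ((-q.num).toNat : ℕ) = q.num := by
        have : ((q.num.toNat : ℕ) : ℤ) - ((-q.num).toNat : ℕ) = q.num := by omega
        exact_mod_cast this
      simp only [t, r, Denumerable.ofNat_encode]
      rw [hd, hn, Rat.num_div_den]
    obtain ⟨i₀, hi₀⟩ := hex
    obtain ⟨i, hi, -⟩ := Nat.rfind_min' (p := fun i => decide (encQ (r (t i)) = encQ q))
      (m := i₀) (by simp [hi₀])
    have hiq : r (t i) = q := hQ (by simpa using Nat.rfind_spec hi)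
    rw [Part.eq_some_iff]
    refine Part.mem_map_iff _ |>.2 ⟨i, hi, ?_⟩
    rw [decide_eq_decide, ← hiq]
    have hpos : (0 : ℚ) < ((t i).2.2 : ℚ) + 1 := by positivity
    simp only [r]
    rw [div_mul_eq_mul_div, lt_div_iff₀ hpos, sub_mul, lt_sub_iff_add_lt']
    exact_mod_cast Iff.rfl

/-- A partial computable function removing a self-delimiting prefix. -/
theorem exists_partrec_strip {bar : List S → List S} (hbar : IsSelfDelimiting bar) :
    ∃ h : List S →. List S, Partrec h ∧ ∀ x w, w ∈ h (bar x ++ w) := by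
  obtain ⟨-, ⟨-, hdec⟩, hpf⟩ := hbar
  obtain ⟨d, hd⟩ := hdec
  -- Cut after the shortest prefix in the image of `bar`; prefix-freeness forces it to be `bar x`.
  refine ⟨fun t => (Nat.rfind fun i => Part.some (decide (t.take i ∈ Set.range bar))).map
    fun i => t.drop i, ?_, ?_⟩
  · refine Partrec.map (f := fun t : List S =>
      Nat.rfind fun i => Part.some (decide (t.take i ∈ Set.range bar))) (Partrec.rfind ?_) ?_
    · exact hd.comp (Primrec.list_take.comp Primrec.snd Primrec.fst).to_comp
    · exact (Primrec.list_drop.comp Primrec.snd Primrec.fst).to_comp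
  · intro x w
    refine Part.mem_map_iff _ |>.2 ⟨(bar x).length, ?_, by simp⟩
    refine Nat.mem_rfind.2 ⟨by simp, fun {m} hm => Part.mem_some_iff.2 ?_⟩
    rw [eq_comm, decide_eq_false_iff_not]
    intro hmem
    rw [List.take_append_of_le_length hm.le] at hmem
    refine hpf _ hmem ((bar x).drop m) (by simpa using hm) ?_
    rw [List.take_append_drop]
    exact ⟨x, rfl⟩

end Search

/-! ### Base `|S|` digits and a short self-delimiting pairing. -/

section Digits

variable {S : Type*} [Fintype S]

/-- The number with the given list of base `|S|` digits, least significant digit first. -/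
noncomputable def digitValue (l : List S) : ℕ :=
  l.foldr (fun s a => (Fintype.equivFin S s : ℕ) + Fintype.card S * a) 0

theorem primrec_digitValue [Primcodable S] : Primrec (digitValue (S := S)) := by
  refine Primrec.list_foldr (f := id) (g := fun _ => 0)
    (h := fun _ q => (Fintype.equivFin S q.1 : ℕ) + Fintype.card S * q.2)
    Primrec.id (Primrec.const 0) ?_
  exact Primrec.nat_add.comp
    ((Primrec.dom_finite fun s => (Fintype.equivFin S s : ℕ)).comp
      (Primrec.fst.comp Primrec.snd))
    (Primrec.nat_mul.comp (Primrec.const _) (Primrec.snd.comp Primrec.snd))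

theorem exists_digitValue_eq [Nonempty S] (k : ℕ) {j : ℕ} (hj : j < Fintype.card S ^ k) :
    ∃ v : List S, v.length = k ∧ digitValue v = j := by
  induction k generalizing j with
  | zero => exact ⟨[], rfl, by simp at hj; simp [digitValue, hj]⟩
  | succ k ih =>
    obtain ⟨v, hv, hvj⟩ := ih (j := j / Fintype.card S)
      (Nat.div_lt_of_lt_mul (by rwa [← pow_succ']))
    refine ⟨(Fintype.equivFin S).symm ⟨j % Fintype.card S, Nat.mod_lt _ Fintype.card_pos⟩ :: v,
      by simp [hv], ?_⟩
    change _ + Fintype.card S * digitValue v = j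
    rw [hvj]
    simp [Nat.mod_add_div]

/-- A primitive recursive pairing of strings that costs twice the logarithm of the length of the
first component. -/
theorem exists_primrec_parse [Nontrivial S] [Primcodable S] :
    ∃ parse : List S → List S × List S, Primrec parse ∧ ∀ t v : List S, ∃ w,
      parse w = (t, v) ∧
        w.length = t.length + 2 * Nat.clog (Fintype.card S) (t.length + 1) + 1 + v.length := by
  classical
  obtain ⟨z, o, hzo⟩ := exists_pair_ne S
  let p : S → Bool := fun s => decide (s ≠ o)
  -- The format is `z ^ n · o · D · t · v`, where `D` holds the length of `t` in `n` digits and the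
  -- position of the first `o` announces `n`. The overhead is `2 * n + 1`.
  let d : List S → ℕ := fun w => (w.takeWhile p).length
  let r : List S → List S := fun w => w.drop (d w + 1)
  let len : List S → ℕ := fun w => digitValue ((r w).take (d w))
  let b : List S → List S := fun w => (r w).drop (d w)
  have hd : Primrec d := Primrec.list_length.comp (Primrec.list_takeWhile (Primrec.dom_finite p))
  have hr : Primrec r := Primrec.list_drop.comp (Primrec.succ.comp hd) Primrec.id
  have hlen : Primrec len := primrec_digitValue.comp (Primrec.list_take.comp hd hr)
  have hb : Primrec b := Primrec.list_drop.comp hd hr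
  refine ⟨fun w => ((b w).take (len w), (b w).drop (len w)),
    (Primrec.list_take.comp hlen hb).pair (Primrec.list_drop.comp hlen hb), ?_⟩
  intro t v
  set n := Nat.clog (Fintype.card S) (t.length + 1) with hn
  obtain ⟨D, hDl, hDv⟩ := exists_digitValue_eq (S := S) n (j := t.length)
    (Nat.lt_of_succ_le (Nat.le_pow_clog Fintype.one_lt_card _))
  let w := List.replicate n z ++ o :: (D ++ (t ++ v))
  have hdw : d w = n := by
    simp only [d, w]
    rw [List.takeWhile_append_of_pos]
    · simp [p]
    · intro a ha
      rw [List.eq_of_mem_replicate ha]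
      simpa [p] using hzo
  have hrw : r w = D ++ (t ++ v) := by
    simp only [r, hdw, w]
    rw [List.drop_append]
    simp
  have hlw : len w = t.length := by
    simp only [len, hrw, hdw, ← hDl, List.take_left, hDv]
  have hbw : b w = t ++ v := by
    simp only [b, hrw, hdw, ← hDl, List.drop_left]
  refine ⟨w, ?_, ?_⟩
  · simp [hlw, hbw]
  · simp [w, hDl]
    ring

end Digits

/-! ### Kraft's inequality and the total mass of the output distribution. -/

section Kraft

theorem IsPrefixFree.eq_of_append_eq {A : Type*} {F : Set (List A)} (hF : IsPrefixFree F)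
    {u v s t : List A} (hu : u ∈ F) (hv : v ∈ F) (h : u ++ s = v ++ t) : u = v := by
  rcases List.append_eq_append_iff.1 h with ⟨z, rfl, -⟩ | ⟨z, rfl, -⟩
  · by_contra hne
    exact hF u hu z (by rintro rfl; simp at hne) hv
  · by_contra hne
    exact hF v hv z (by rintro rfl; simp at hne) hu

/-- Peeling off first code words reduces Kraft's inequality to the Kraft–McMillan theorem. The empty
word must be excluded, since it can be inserted anywhere without changing a concatenation. -/
theorem IsPrefixFree.uniquelyDecodable {A : Type*} {F : Set (List A)} (hF : IsPrefixFree F)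
    (hnil : [] ∉ F) : InformationTheory.UniquelyDecodable F := by
  intro L₁
  induction L₁ with
  | nil =>
    intro L₂ _ h₂ h
    cases L₂ with
    | nil => rfl
    | cons v L₂ =>
      have : v = [] := by simp at h; exact h.1
      exact absurd (this ▸ h₂ v (by simp)) hnil
  | cons u L₁ ih =>
    intro L₂ h₁ h₂ h
    cases L₂ with
    | nil =>
      have : u = [] := by simp at h; exact h.1
      exact absurd (this ▸ h₁ u (by simp)) hnil
    | cons v L₂ =>
      simp only [List.flatten_cons] at h
      obtain rfl := hF.eq_of_append_eq (h₁ u (by simp)) (h₂ v (by simp)) h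
      rw [ih L₂ (fun w hw => h₁ w (by simp [hw])) (fun w hw => h₂ w (by simp [hw]))
        (List.append_cancel_left h)]

/-- Kraft's inequality for an arbitrary prefix-free set of strings over `{0, …, n - 1}`. -/
theorem IsPrefixFree.tsum_pow_length_le_one {n : ℕ} {F : Set (List (Fin n))}
    (hF : IsPrefixFree F) : ∑' u : F, ((n : ℝ≥0∞)⁻¹) ^ u.1.length ≤ 1 := by
  classical
  by_cases hnil : [] ∈ F
  · have hF' : ∀ u : F, u = ⟨[], hnil⟩ := by
      rintro ⟨u, hu⟩
      by_contra hne
      exact hF [] hnil u (by rintro rfl; exact hne rfl) hu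
    rw [tsum_eq_single (⟨[], hnil⟩ : F) (fun u hu => absurd (hF' u) hu)]
    simp
  -- Over the empty alphabet the only word is the empty one, already excluded.
  rcases n with _ | n
  · have : IsEmpty F := ⟨fun ⟨u, hu⟩ => by
      cases u with
      | nil => exact hnil hu
      | cons a => exact a.elim0⟩
    simp
  rw [ENNReal.tsum_eq_iSup_sum]
  refine iSup_le fun s => ?_
  let T : Finset (List (Fin (n + 1))) := s.map (Function.Embedding.subtype _)
  have hT : InformationTheory.UniquelyDecodable (T : Set (List (Fin (n + 1)))) := by
    have hu := hF.uniquelyDecodable hnil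
    have hTF : ∀ w ∈ (T : Set (List (Fin (n + 1)))), w ∈ F := by
      intro w hw
      simp only [T, Finset.coe_map, Set.mem_image] at hw
      obtain ⟨a, -, rfl⟩ := hw
      exact a.2
    exact fun L₁ L₂ h₁ h₂ => hu L₁ L₂ (fun w hw => hTF w (h₁ w hw)) (fun w hw => hTF w (h₂ w hw))
  have hk := InformationTheory.kraft_mcmillan_inequality hT
  have hs : ∑ u ∈ s, (((n + 1 : ℕ) : ℝ≥0∞)⁻¹) ^ u.1.length =
      ENNReal.ofReal (∑ w ∈ T, (1 / (Fintype.card (Fin (n + 1))) : ℝ) ^ w.length) := by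
    rw [ENNReal.ofReal_sum_of_nonneg (fun _ _ => by positivity)]
    simp only [T, Finset.sum_map]
    refine Finset.sum_congr rfl fun u _ => ?_
    rw [ENNReal.ofReal_pow (by positivity), one_div, ENNReal.ofReal_inv_of_pos (by positivity),
      ENNReal.ofReal_natCast, Fintype.card_fin]
    rfl
  rw [hs]
  exact ENNReal.ofReal_le_one.2 hk

variable {S X Y : Type*} [Primcodable S] [Fintype S] {bar : List S → List S}
  {encX : X → List S} {encY : Y → List S} {encN : ℕ → List S} {encB : Bool → List S}
  {encR : ∀ n : ℕ, List (Fin n) → List S}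

/-- Each accepted random sequence yields at most one output, so the sums for different `y` run over
disjoint parts of a prefix-free set. -/
theorem StochasticAI.tsum_prob_le_one (A : StochasticAI bar encX encY encN encB encR) {x : X}
    (hx : x ∈ A.dom) : ∑' y, A.prob x y ≤ 1 := by
  refine le_trans ?_ (A.accepted_prefixFree x hx).tsum_pow_length_le_one
  unfold StochasticAI.prob
  rw [← ENNReal.tsum_sigma]
  let φ : (Σ y, {u : List (Fin A.n) // true ∈ A.accept (u, x) ∧ y ∈ A.main (u, x)}) →
      {u | true ∈ A.accept (u, x)} := fun z => ⟨z.2.1, z.2.2.1⟩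
  have hφ : Function.Injective φ := by
    rintro ⟨y, u, hu⟩ ⟨y', u', hu'⟩ h
    obtain rfl : u = u' := congrArg Subtype.val h
    obtain rfl : y = y' := Part.mem_unique hu.2 hu'.2
    rfl
  exact ENNReal.tsum_comp_le_tsum_of_injective hφ fun u => ((A.n : ℝ≥0∞)⁻¹) ^ u.1.length

theorem StochasticAI.prob_le_one (A : StochasticAI bar encX encY encN encB encR) {x : X}
    (hx : x ∈ A.dom) (y : Y) : A.prob x y ≤ 1 :=
  (ENNReal.le_tsum y).trans (A.tsum_prob_le_one hx)

theorem StochasticAI.sum_prob_toReal_le_one (A : StochasticAI bar encX encY encN encB encR)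
    {x : X} (hx : x ∈ A.dom) (s : Finset Y) : ∑ y ∈ s, (A.prob x y).toReal ≤ 1 := by
  rw [← ENNReal.toReal_sum fun y _ => ne_top_of_le_ne_top ENNReal.one_ne_top (A.prob_le_one hx y)]
  exact ENNReal.toReal_le_of_le_ofReal zero_le_one
    (by simpa using (ENNReal.sum_le_tsum s).trans (A.tsum_prob_le_one hx))

end Kraft

/-! ### Recovering an output from an explanation and a rank. -/

section Decoder

variable {S : Type*} [Fintype S] [Primcodable S]

/-- A partial computable test whether the number `n` codes an output whose interpreted probability, at
precision `k`, exceeds `|S| ^ (1 - k)`. -/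
theorem exists_partrec_select {bar : List S → List S} (hbar : Computable bar)
    {encN : ℕ → List S} (hNc : Computable encN)
    {encQ : ℚ → List S} (hQ : Function.Injective encQ) (hQc : ComputableRatEncoding encQ)
    {Y : Type*} {encY : Y → List S} (hY : IsEncoding encY)
    {Z : Type*} {encZ : Z → List S} {I : Z × ℕ × Y →. ℚ}
    (hI : PartialComputable (encPair bar encZ (encPair bar encN encY)) encQ I) :
    ∃ P : List S × ℕ → ℕ →. Bool, Partrec₂ P ∧ ∀ (e : Z) (k : ℕ) (q : Y → ℚ),
      (∀ y, q y ∈ I (e, k, y)) → ∀ (n : ℕ) (b : Bool),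
        (b = true ↔ ∃ y, Encodable.encode (encY y) = n ∧
          (Fintype.card S : ℚ) < q y * (Fintype.card S : ℚ) ^ k) →
        P (encZ e, k) n = Part.some b := by
  obtain ⟨g, hg, hgI⟩ := hI
  obtain ⟨T, hT, hTq⟩ := exists_partrec_rat_test hQ hQc (Fintype.card S)
  obtain ⟨hYinj, dY, hdY⟩ := hY
  -- The interpretation is run only on genuine codes of outputs, as it may diverge elsewhere and
  -- block the search.
  let R : List S × ℕ → List S →. Bool := fun a s =>
    cond (decide (s ∈ Set.range encY))
      ((g (bar a.1 ++ (bar (encN a.2) ++ s))).bind fun r => T a.2 r) (Part.some false)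
  have hR : Partrec₂ R := by
    refine Partrec.cond (hdY.comp Computable.snd) (Partrec.bind (hg.comp ?_) ?_)
      (Computable.const false)
    · exact Computable.list_append.comp
        (hbar.comp (Computable.fst.comp Computable.fst))
        (Computable.list_append.comp
          (hbar.comp (hNc.comp (Computable.snd.comp Computable.fst))) Computable.snd)
    · exact hT.comp (Computable.snd.comp (Computable.fst.comp Computable.fst)) Computable.snd
  -- `decode₂` accepts only `n = encode s`, so no output is counted at two numbers.
  refine ⟨fun a n => Option.casesOn (motive := fun _ => Part Bool) (Encodable.decode₂ (List S) n)
    (Part.some false) (R a), ?_, ?_⟩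
  · exact Partrec.optionCasesOn_right (o := fun q : (List S × ℕ) × ℕ =>
      Encodable.decode₂ (List S) q.2) (f := fun _ => false) (g := fun q s => R q.1 s)
      (Primrec.decode₂.to_comp.comp Computable.snd) (Computable.const false)
      (hR.comp (Computable.fst.comp Computable.fst) Computable.snd)
  · intro e k q hq n b hb
    rcases hn : Encodable.decode₂ (List S) n with _ | s
    · have : b = false := by
        rw [← Bool.not_eq_true, hb]
        rintro ⟨y, hy, -⟩
        rw [Encodable.mem_decode₂.2 hy] at hn
        cases hn
      simp [hn, this]
    have hs : Encodable.encode s = n := Encodable.mem_decode₂.1 hn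
    simp only [hn]
    by_cases hsY : s ∈ Set.range encY
    · obtain ⟨y, rfl⟩ := hsY
      have hgy : g (bar (encZ e) ++ (bar (encN k) ++ encY y)) = Part.some (encQ (q y)) := by
        have := hgI (e, k, y)
        rw [Part.eq_some_iff.2 (hq y), Part.map_some] at this
        exact this
      simp only [R, Set.mem_range_self, decide_true, cond_true, hgy, Part.bind_some, hTq]
      congr 1
      rw [Bool.eq_iff_iff, hb, decide_eq_true_iff]
      constructor
      · exact fun h => ⟨y, hs, h⟩
      · rintro ⟨y', hy', h⟩
        rw [← hs] at hy'
        rwa [← hYinj (Encodable.encode_injective hy')]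
    · have : b = false := by
        rw [← Bool.not_eq_true, hb]
        rintro ⟨y, hy, -⟩
        rw [← hs] at hy
        exact hsY ⟨y, Encodable.encode_injective hy⟩
      simp [R, hsY, this]

/-- A decoder that recovers an output `y` with `|S| ^ (-m) ≤ g y` from an explanation of `g` and
`m + 2` further letters. -/
theorem exists_partrec_decoder [Nontrivial S] {bar : List S → List S} (hbar : IsSelfDelimiting bar)
    {encN : ℕ → List S} (hNc : Computable encN)
    {encQ : ℚ → List S} (hQ : Function.Injective encQ) (hQc : ComputableRatEncoding encQ)
    {Y : Type*} {encY : Y → List S} (hY : IsEncoding encY)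
    {L : Type*} {encL : L → List S} {I : List L × ℕ × Y →. ℚ}
    (hI : PartialComputable (encPair bar (encString encL) (encPair bar encN encY)) encQ I) :
    ∃ f : List S →. List S, Partrec f ∧ ∀ (x : List S) (e : List L) (g : Y → ℝ),
      IsFaithfulExplanation S I e g → (∀ s : Finset Y, ∑ y ∈ s, g y ≤ 1) →
      ∀ (y : Y) (m : ℕ), ((Fintype.card S : ℝ) ^ m)⁻¹ ≤ g y →
      ∃ w, encY y ∈ f (bar x ++ w) ∧ w.length = (encString encL e).length +
        2 * Nat.clog (Fintype.card S) ((encString encL e).length + 1) + 1 + (m + 2) := by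
  classical
  obtain ⟨P, hP, hPsel⟩ := exists_partrec_select hbar.1 hNc hQ hQc hY hI
  obtain ⟨F, hF, hFnth⟩ := exists_partrec_nth hP
  obtain ⟨h, hh, hstrip⟩ := exists_partrec_strip hbar
  obtain ⟨parse, hparse, hparse_surj⟩ := exists_primrec_parse (S := S)
  -- The number of rank letters is itself the precision `k`, so `k` needs no separate code.
  refine ⟨fun t => (h t).bind fun w =>
    (F ((parse w).1, (parse w).2.length) (digitValue (parse w).2)).bind fun n =>
      (Encodable.decode (α := List S) n : Part (List S)), ?_, ?_⟩
  · refine Partrec.bind hh (Partrec.bind ?_ ?_)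
    · have hp : Computable fun q : List S × List S => parse q.2 :=
        hparse.to_comp.comp Computable.snd
      exact hF.comp ((Computable.fst.comp hp).pair
        (Computable.list_length.comp (Computable.snd.comp hp)))
        (primrec_digitValue.to_comp.comp (Computable.snd.comp hp))
    · exact Computable.ofOption (Computable.decode.comp Computable.snd)
  intro x e g hg hsum y m hm
  set B := Fintype.card S with hB
  have hB2 : 2 ≤ B := Fintype.one_lt_card
  have hB2' : (2 : ℝ) ≤ B := by exact_mod_cast hB2
  -- After scaling by `B ^ k` the error is below 1. The target has `g y * B ^ k ≥ B ^ 2`, so it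
  -- passes since `B ^ 2 - 1 ≥ B`; anything that passes has scaled probability above `B - 1 ≥ 1`.
  set k := m + 2 with hk
  have hBk : (0 : ℝ) < (B : ℝ) ^ k := by positivity
  choose q hq hqg using fun y => hg y k
  have hqB : ∀ y, |(q y : ℝ) * (B : ℝ) ^ k - g y * (B : ℝ) ^ k| < 1 := by
    intro y
    rw [← sub_mul, abs_mul, abs_of_pos hBk]
    calc _ < ((B : ℝ) ^ k)⁻¹ * (B : ℝ) ^ k := by gcongr; exact hqg y
      _ = 1 := inv_mul_cancel₀ hBk.ne'
  let p : ℕ → Prop := fun n => ∃ y, Encodable.encode (encY y) = n ∧ (B : ℚ) < q y * (B : ℚ) ^ k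
  have hcast : ∀ y, (B : ℚ) < q y * (B : ℚ) ^ k ↔ (B : ℝ) < q y * (B : ℝ) ^ k := by
    intro y
    exact_mod_cast Iff.rfl
  have hPp : ∀ n, P (encString encL e, k) n = Part.some (decide (p n)) := fun n =>
    hPsel e k q hq n _ (by simp [p])
  -- The members up to and including `n` number at most `B ^ k`, so the rank of `n`, which omits
  -- `n`, is strictly smaller.
  have hcount : ∀ n, p n → Nat.count p n < B ^ k := by
    intro n hn
    have hsucc : Nat.count p (n + 1) = Nat.count p n + 1 := by simp [Nat.count_succ, hn]
    refine Nat.lt_of_succ_le ?_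
    rw [Nat.succ_eq_add_one, ← hsucc, Nat.count_eq_card_filter_range]
    set s := (Finset.range (n + 1)).filter p
    have hs : ∀ a : s, p a := fun a => (Finset.mem_filter.1 a.2).2
    choose z hz hzq using hs
    have hzinj : Function.Injective z := by
      intro a b hab
      apply Subtype.ext
      rw [← hz a, ← hz b, hab]
    have h1 : ∀ a, ((B : ℝ) ^ k)⁻¹ ≤ g (z a) := by
      intro a
      have h2 := (hcast _).1 (hzq a)
      have h3 := (abs_lt.1 (hqB (z a))).2
      rw [inv_le_iff_one_le_mul₀ hBk]
      linarith
    have h2 := hsum (Finset.univ.image z)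
    rw [Finset.sum_image fun a _ b _ hab => hzinj hab] at h2
    have h3 := (Finset.sum_le_sum fun a (_ : a ∈ Finset.univ) => h1 a).trans h2
    rw [Finset.sum_const, Finset.card_univ, Fintype.card_coe, nsmul_eq_mul,
      ← div_eq_mul_inv, div_le_one hBk] at h3
    exact_mod_cast h3
  have hpy : p (Encodable.encode (encY y)) := by
    refine ⟨y, rfl, (hcast y).2 ?_⟩
    have h1 := (abs_lt.1 (hqB y)).1
    have h2 : (B : ℝ) ^ 2 ≤ g y * (B : ℝ) ^ k := by
      calc (B : ℝ) ^ 2 = ((B : ℝ) ^ m)⁻¹ * (B : ℝ) ^ k := by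
            rw [hk, pow_add, inv_mul_cancel_left₀ (by positivity)]
        _ ≤ _ := by gcongr
    nlinarith
  obtain ⟨v, hvk, hv⟩ := exists_digitValue_eq (S := S) k (hcount _ hpy)
  obtain ⟨w, hw, hwlen⟩ := hparse_surj (encString encL e) v
  refine ⟨w, ?_, by rw [hwlen, hvk]⟩
  refine Part.mem_bind (hstrip x w) ?_
  rw [hw]
  refine Part.mem_bind (a := Encodable.encode (encY y)) ?_ (by simp)
  simp only [hvk, hv]
  exact hFnth _ p hPp _ hpy

end Decoder

/-! ### Length and logarithm estimates; expectations in the extended reals. -/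

section Bounds

theorem length_encString_le {S L : Type*} [Fintype L] (encL : L → List S) (e : List L) :
    (encString encL e).length ≤ maxCodeLength encL * e.length := by
  induction e with
  | nil => simp [encString]
  | cons a e ih =>
    have ha : (encL a).length ≤ maxCodeLength encL :=
      Finset.le_sup (f := fun a => (encL a).length) (Finset.mem_univ a)
    simp only [encString, List.map_cons, List.flatten_cons, List.length_append,
      List.length_cons] at ih ⊢
    rw [mul_add, mul_one]
    omega

theorem clog_le_logb_add_one {b n : ℕ} (hb : 1 < b) (hn : 0 < n) :
    (Nat.clog b n : ℝ) ≤ Real.logb b n + 1 := by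
  rw [← Real.natCeil_logb_natCast]
  exact (Nat.ceil_lt_add_one (Real.logb_nonneg (by exact_mod_cast hb) (by exact_mod_cast hn))).le

theorem inv_pow_ceil_neg_logb_le {b : ℕ} (hb : 1 < b) {q : ℝ} (hq : 0 < q) :
    ((b : ℝ) ^ ⌈-Real.logb b q⌉₊)⁻¹ ≤ q := by
  have hb' : (1 : ℝ) < b := by exact_mod_cast hb
  rw [← Real.rpow_natCast, ← Real.rpow_neg (by positivity), ← Real.le_logb_iff_rpow_le hb' hq]
  linarith [Nat.le_ceil (-Real.logb b q)]

theorem negLog_nonneg {b : ℕ} (hb : 1 < b) {q : ℝ≥0∞} (hq : q ≤ 1) : 0 ≤ negLog b q := by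
  unfold negLog
  split_ifs with h
  · exact le_top
  · have hq' : q.toReal ≤ 1 := ENNReal.toReal_le_of_le_ofReal zero_le_one (by simpa using hq)
    have := Real.logb_nonpos (b := b) (by exact_mod_cast hb) ENNReal.toReal_nonneg hq'
    exact_mod_cast neg_nonneg.2 this

/-- Points outside the support have weight 0, so nonnegativity is needed only on it; this matters
because the probabilities are controlled only on the domain of the AI. -/
theorem expect_of_nonneg {Z : Type*} {P : PMF Z} {F : Z → EReal}
    (hF : ∀ z ∈ P.support, 0 ≤ F z) :
    expect P F = ((∑' z, P z * (F z).toENNReal : ℝ≥0∞) : EReal) := by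
  have : ∑' z, P z * (-F z).toENNReal = 0 := by
    rw [ENNReal.tsum_eq_zero]
    intro z
    by_cases hz : P z = 0
    · simp [hz]
    · have hz' := hF z ((P.mem_support_iff z).2 hz)
      rw [EReal.toENNReal_of_nonpos (EReal.neg_le_zero.2 hz'), mul_zero]
  simp [expect, this]

/-- With the constant moved to the larger side, everything becomes a sum in `ℝ≥0∞`, where additivity
needs no summability and `P` has total mass 1. -/
theorem expect_sub_le_of_le_add {Z : Type*} {P : PMF Z} {F G H : Z → EReal} (c : ℕ)
    (hF : ∀ z ∈ P.support, 0 ≤ F z) (hG : ∀ z ∈ P.support, 0 ≤ G z)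
    (hH : ∀ z ∈ P.support, 0 ≤ H z)
    (h : ∀ z ∈ P.support, F z ≤ G z + H z + c) :
    expect P F - c ≤ expect P G + expect P H := by
  rw [expect_of_nonneg hF, expect_of_nonneg hG, expect_of_nonneg hH]
  apply EReal.sub_le_of_le_add
  have hcE : ((c : ℝ≥0∞) : EReal) = (c : EReal) := by
    rw [← ENNReal.ofReal_natCast, EReal.coe_ennreal_ofReal, max_eq_left (Nat.cast_nonneg c),
      EReal.coe_coe_eq_natCast]
  have key : ∑' z, P z * (F z).toENNReal ≤
      ∑' z, P z * (G z).toENNReal + ∑' z, P z * (H z).toENNReal + c := by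
    calc ∑' z, P z * (F z).toENNReal
        ≤ ∑' z, (P z * (G z).toENNReal + P z * (H z).toENNReal + P z * c) := by
          refine ENNReal.tsum_le_tsum fun z => ?_
          by_cases hz : P z = 0
          · simp [hz]
          have hz' := (P.mem_support_iff z).2 hz
          rw [← mul_add, ← mul_add]
          gcongr
          have hc : (0 : EReal) ≤ (c : EReal) := by exact_mod_cast Nat.zero_le c
          calc (F z).toENNReal ≤ (G z + H z + c).toENNReal := EReal.toENNReal_le_toENNReal (h z hz')
            _ = _ := by
              rw [EReal.toENNReal_add (add_nonneg (hG z hz') (hH z hz')) hc,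
                EReal.toENNReal_add (hG z hz') (hH z hz')]
              congr 1
              rw [← hcE, EReal.toENNReal_coe]
      _ = _ := by
          rw [ENNReal.tsum_add, ENNReal.tsum_add, ENNReal.tsum_mul_right, P.tsum_coe, one_mul]
  rw [← hcE]
  exact_mod_cast key

end Bounds

end Quadrilemma

/-! ### The quadrilemma. -/

open Quadrilemma in
theorem theorem1
    -- the alphabet of the computation model, the pairing, and the universal machine
    {S : Type*} [Fintype S] [Nontrivial S] [Primcodable S]
    (bar : List S → List S) (hbar : IsSelfDelimiting bar)
    (U : List S →. List S) (hU : IsUniversalConditional bar U)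
    -- the fixed encodings of `ℕ`, `ℚ`, `{0, 1}` and `{0, …, n - 1}*`
    (encN : ℕ → List S) (hN : IsEncoding encN) (hNc : Computable encN)
    (encQ : ℚ → List S) (hQ : IsEncoding encQ) (hQc : ComputableRatEncoding encQ)
    (encB : Bool → List S) (hB : IsEncoding encB)
    (encR : ∀ n : ℕ, List (Fin n) → List S) (hR : ∀ n, IsEncoding (encR n))
    (hRc : ∀ n, Computable (encR n))
    -- the output space
    {Y : Type*} (encY : Y → List S) (hY : IsEncoding encY)
    -- the explanation alphabet with its prefix-free code, and the interpretation function
    {L : Type*} [Fintype L] (encL : L → List S) (hL : Function.Injective encL)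
    (hLpf : IsPrefixFree (Set.range encL))
    (I : List L × ℕ × Y →. ℚ)
    (hI : PartialComputable (encPair bar (encString encL) (encPair bar encN encY)) encQ I) :
    ∃ c : ℝ, ∀ (X : Type*) (encX : X → List S), IsEncoding encX →
      ∀ A : StochasticAI bar encX encY encN encB encR,
        (∀ x ∈ A.dom, ∀ (y : Y) (e : List L),
          IsFaithfulExplanation S I e (fun y => (A.prob x y).toReal) →
          ((plainComplexity bar U (encY y) (encX x) : ℝ) : EReal) + (c : EReal) ≤
            negLog (Fintype.card S) (A.prob x y) +
              ((maxCodeLength encL * e.length : ℝ) +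
                2 * Real.logb (Fintype.card S) (maxCodeLength encL * e.length + 1) : ℝ)) ∧
        (∀ e : X → List L,
          (∀ x ∈ A.dom, IsFaithfulExplanation S I (e x) (fun y => (A.prob x y).toReal)) →
          ∀ P : PMF (X × Y), (∀ z ∈ P.support, z.1 ∈ A.dom) →
          expect P (fun z => ((plainComplexity bar U (encY z.2) (encX z.1) : ℝ) : EReal)) +
              (c : EReal) ≤
            expect P (fun z => negLog (Fintype.card S) (A.prob z.1 z.2)) +
              expect P (fun z => (((maxCodeLength encL * (e z.1).length : ℝ) +
                2 * Real.logb (Fintype.card S) (maxCodeLength encL * (e z.1).length + 1) : ℝ) :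
                  EReal))) := by
  obtain ⟨f, hf, hdec⟩ := exists_partrec_decoder hbar hNc hQ.1 hQc hY hI
  obtain ⟨-, programs, -, -, huniv⟩ := hU
  obtain ⟨p, -, hp⟩ := huniv f hf
  set b := Fintype.card S with hb
  have hb1 : 1 < b := Fintype.one_lt_card
  have hb1' : (1 : ℝ) < b := by exact_mod_cast hb1
  have hcast : (((-((p.length + 6 : ℕ) : ℝ) : ℝ)) : EReal) = -((p.length + 6 : ℕ) : EReal) := by
    push_cast
    rfl
  -- The 6 is 1 for the separator `o`, 2 for rounding up the doubled logarithm, 2 for the extra rank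
  -- letters and 1 for rounding up `-log Q`.
  refine ⟨-((p.length + 6 : ℕ) : ℝ), fun X encX _ A => ?_⟩
  have key : ∀ x ∈ A.dom, ∀ (y : Y) (e : List L),
      IsFaithfulExplanation S I e (fun y => (A.prob x y).toReal) →
      ((plainComplexity bar U (encY y) (encX x) : ℝ) : EReal) ≤
        negLog b (A.prob x y) + ((maxCodeLength encL * e.length : ℝ) +
          2 * Real.logb b (maxCodeLength encL * e.length + 1) : ℝ) +
            ((p.length + 6 : ℕ) : EReal) := by
    intro x hx y e he
    have hle := A.prob_le_one hx y
    unfold negLog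
    split_ifs with h0
    -- At probability 0 the right side is `⊤`; no description of `y` is needed.
    · rw [EReal.top_add_coe, ← EReal.coe_coe_eq_natCast, EReal.top_add_coe]
      exact le_top
    have hq : 0 < (A.prob x y).toReal :=
      ENNReal.toReal_pos h0 (ne_top_of_le_ne_top ENNReal.one_ne_top hle)
    have hq1 : (A.prob x y).toReal ≤ 1 :=
      ENNReal.toReal_le_of_le_ofReal zero_le_one (by simpa using hle)
    have hlog : 0 ≤ -Real.logb b (A.prob x y).toReal :=
      neg_nonneg.2 (Real.logb_nonpos hb1' hq.le hq1)
    obtain ⟨w, hw, hwlen⟩ := hdec (encX x) e _ he (A.sum_prob_toReal_le_one hx) y _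
      (inv_pow_ceil_neg_logb_le hb1 hq)
    have hC : plainComplexity bar U (encY y) (encX x) ≤ (p ++ w).length :=
      Nat.sInf_le ⟨p ++ w, by rwa [← List.append_assoc, hp], rfl⟩
    rw [List.length_append, hwlen] at hC
    have hC' : (plainComplexity bar U (encY y) (encX x) : ℝ) ≤ p.length +
        ((encString encL e).length + 2 * Nat.clog b ((encString encL e).length + 1) + 1 +
          (⌈-Real.logb b (A.prob x y).toReal⌉₊ + 2)) := by exact_mod_cast hC
    have h1 : ((encString encL e).length : ℝ) ≤ maxCodeLength encL * e.length := by
      exact_mod_cast length_encString_le encL e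
    have h2 : (Nat.clog b ((encString encL e).length + 1) : ℝ) ≤
        Real.logb b (maxCodeLength encL * e.length + 1) + 1 := by
      refine (clog_le_logb_add_one hb1 (Nat.succ_pos _)).trans ?_
      push_cast
      gcongr
    have h3 := (Nat.ceil_lt_add_one hlog).le
    rw [← EReal.coe_coe_eq_natCast, ← EReal.coe_add, ← EReal.coe_add, EReal.coe_le_coe_iff]
    push_cast
    linarith
  refine ⟨fun x hx y e he => ?_, fun e he P hP => ?_⟩
  · rw [hcast, ← sub_eq_add_neg]
    exact EReal.sub_le_of_le_add (key x hx y e he)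
  · rw [hcast, ← sub_eq_add_neg]
    refine expect_sub_le_of_le_add _ (fun z _ => ?_) (fun z hz => ?_) (fun z _ => ?_)
      (fun z hz => key z.1 (hP z hz) z.2 (e z.1) (he z.1 (hP z hz)))
    · exact_mod_cast Nat.zero_le _
    · exact negLog_nonneg hb1 (A.prob_le_one (hP z hz) z.2)
    · have : 0 ≤ Real.logb b (maxCodeLength encL * (e z.1).length + 1) :=
        Real.logb_nonneg hb1' (le_add_of_nonneg_left (by positivity))
      rw [EReal.coe_nonneg]
      positivity
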